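/- A bipartite graph is a triple $\Gamma=(L,R,E)$ with disjoint non-empty sets $L$ (left vertices) and $R$ (right vertices) and a set $E$ of edges, each joining a left vertex to a right vertex. It is complete if every left vertex is joined to every right vertex, and empty if $E=\emptyset$. A partial automorphism of $\Gamma$ is an injective partial map from $L\cup R$ to itself which maps left vertices to left vertices and right vertices to right vertices and preserves edges and non-edges; an automorphism is a partial automorphism that is a bijection of $L\cup R$. $\Gamma$ is homogeneous if every partial automorphism with finite domain extends to an automorphism. For cardinals $\kappa<\lambda$, a $(\kappa,\lambda)$ saS graph is a homogeneous bipartite graph, neither complete nor empty, with $|L|=\kappa$ and $|R|=\lambda$. $\Gamma$ is locally $3$-symmetric if there is a set $H$ of automorphisms such that for every vertex $v$ and all triples $(x_1,x_2,x_3)$ and $(y_1,y_2,y_3)$, each consisting of distinct neighbours of $v$, some $\varphi\in H$ satisfies $\varphi(v)=v$ and $\varphi(x_i)=y_i$ for $i=1,2,3$. **Theorem 1.5.** There is an $(\aleph_0,2^{\aleph_0})$ saS graph. Moreover, there is such a graph which is connected, has girth $4$ and is locally $3$-symmetric. In particular, the question of Kupitz and Perles, whether in every connected, locally $3$-symmetric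 bipartite graph of girth $4$ which is not a complete bipartite graph both sides have equal cardinality, has a negative answer. -/

import Mathlib

universe u

/-- A bipartite graph `⟨L, R, E⟩` with a distinguished non-empty left side and a distinguished
non-empty right side. The sides are types, so disjointness is built in. -/
structure BipartiteGraph where
  /-- the left vertices -/
  L : Type u
  /-- the right vertices -/
  R : Type u
  /-- the edges -/
  E : L → R → Prop
  nonempty_L : Nonempty L
  nonempty_R : Nonempty R

namespace BipartiteGraph

/-- The set of vertices, i.e. the disjoint union of the two sides. -/
abbrev Vertex (Γ : BipartiteGraph.{u}) : Type u := Γ.L ⊕ Γ.R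

/-- The underlying (undirected) simple graph on the vertices. -/
def toSimpleGraph (Γ : BipartiteGraph.{u}) : SimpleGraph Γ.Vertex where
  Adj u v := match u, v with
    | Sum.inl x, Sum.inr y => Γ.E x y
    | Sum.inr y, Sum.inl x => Γ.E x y
    | Sum.inl _, Sum.inl _ => False
    | Sum.inr _, Sum.inr _ => False
  symm := ⟨by rintro (x | y) (x' | y') h <;> exact h⟩
  loopless := ⟨by rintro (x | y) h <;> exact h⟩

/-- Every left vertex is joined to every right vertex. -/
def IsComplete (Γ : BipartiteGraph.{u}) : Prop := ∀ x y, Γ.E x y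

/-- There are no edges. -/
def IsEmptyGraph (Γ : BipartiteGraph.{u}) : Prop := ∀ x y, ¬ Γ.E x y

/-- The restriction of `f` to `s` is a partial isomorphism from `Γ` to `Γ'` with domain `s`: it is
one-to-one, maps left vertices to left vertices and right vertices to right vertices, and preserves
edges and non-edges. (Values of `f` outside `s` are irrelevant.) -/
structure IsPartialIso (Γ Γ' : BipartiteGraph.{u}) (s : Set Γ.Vertex)
    (f : Γ.Vertex → Γ'.Vertex) : Prop where
  injOn : Set.InjOn f s
  left : ∀ v ∈ s, v.isLeft → (f v).isLeft
  right : ∀ v ∈ s, v.isRight → (f v).isRight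
  adj_iff : ∀ v ∈ s, ∀ w ∈ s, Γ.toSimpleGraph.Adj v w ↔ Γ'.toSimpleGraph.Adj (f v) (f w)

/-- The (side-preserving) automorphisms of `Γ`. -/
def automorphisms (Γ : BipartiteGraph.{u}) : Set (Equiv.Perm Γ.Vertex) :=
  {g | IsPartialIso Γ Γ Set.univ g}

/-- Every finite partial automorphism extends to an automorphism. -/
def IsHomogeneous (Γ : BipartiteGraph.{u}) : Prop :=
  ∀ (s : Set Γ.Vertex) (f : Γ.Vertex → Γ.Vertex), s.Finite → IsPartialIso Γ Γ s f →
    ∃ g ∈ Γ.automorphisms, Set.EqOn g f s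

/-- A `(κ, μ)` saS graph. -/
structure IsSaS (Γ : BipartiteGraph.{u}) (κ μ : Cardinal.{u}) : Prop where
  card_L : Cardinal.mk Γ.L = κ
  card_R : Cardinal.mk Γ.R = μ
  lt : κ < μ
  homogeneous : Γ.IsHomogeneous
  not_complete : ¬ Γ.IsComplete
  not_empty : ¬ Γ.IsEmptyGraph

/-- Local `n`-symmetry: some set `H` of automorphisms is such that, for every vertex `v`, any
`n`-tuple of (distinct) neighbours of `v` can be moved to any other such `n`-tuple by an element of
`H` fixing `v`. -/
def IsLocallySymmetric (Γ : BipartiteGraph.{u}) (n : ℕ) : Prop :=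
  ∃ H ⊆ Γ.automorphisms, ∀ (v : Γ.Vertex) (x y : Fin n → Γ.Vertex),
    Function.Injective x → Function.Injective y →
    (∀ i, Γ.toSimpleGraph.Adj v (x i)) → (∀ i, Γ.toSimpleGraph.Adj v (y i)) →
    ∃ φ ∈ H, φ v = v ∧ ∀ i, φ (x i) = y i

end BipartiteGraph

/-!
The left vertices are codes, that is, finite labelled trees, of which there are countably many; the
right vertices are pairs `(r, x)` of a code `r` and a set `x` of natural numbers, of which there are
continuum many. Each code has a level. The edges between `l` and `(r, x)` are decided by the code of
higher level (by both if the levels are equal): `l` is a child of `r`, or `r` is a child of `l` with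
a label that agrees with `x` below the level of `l`. So a left vertex of level at most `m` sees only
`x ∩ [0, m)`.

For each `m`, the vertices of level at most `m` with `x ⊆ [0, m)` form a countable set, the core.
It has the extension property of the random bipartite graph, because a fresh node with any given
finite set of children exists (`exists_core_extension`); hence by back-and-forth
(`exists_backAndForth`) its finite partial automorphisms extend to automorphisms of the core.

An automorphism of the core is lifted to all right vertices of level at most `m` by translations
`x ↦ x ∆ c`, with `c` depending on `r` and on `x ∩ [0, m)` only. Here finitely many values of `c`
can be prescribed (`IsCoreAut.exists_realizes`). Then it is extended to all codes of higher level by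
recursion along the children (`LevelMap.extend`), which preserves edges since edges at these levels
are given by the relation of being a child (`LevelMap.IsHom.edge_extend`).

Given a finite partial automorphism of the whole graph, truncation at a large level `m` is injective
on its domain and on its range and preserves edges, so the partial automorphism induces one of the
core, and extends by the above. This is homogeneity (`isHomogeneous`). Connectedness and girth `4`
follow from the extension property, and local symmetry from homogeneity.
-/

open Set
open scoped symmDiff

/-! ### Codes -/

/-- Codes for vertices: finite trees whose nodes carry a level, a serial number, and a finite
sequence of children, each labelled by a finite set of natural numbers. -/
inductive Code : Type
  | node (level serial arity : ℕ) (label : Fin arity → Finset ℕ) (child : Fin arity → Code) : Code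

namespace Code

/-- The level of the root of a code. -/
def level : Code → ℕ
  | node M _ _ _ _ => M

/-- The number of children of a code. -/
def arity : Code → ℕ
  | node _ _ k _ _ => k

/-- The labels of the children of a code. -/
def label : (t : Code) → Fin t.arity → Finset ℕ
  | node _ _ _ s _ => s

/-- The children of a code. -/
def child : (t : Code) → Fin t.arity → Code
  | node _ _ _ _ c => c

@[simp] lemma level_node (M n k s c) : (node M n k s c).level = M := rfl

/-- The embedding of codes into a Mathlib `W`-type, used only to see that there are countably
many codes. -/
def toWType : Code → WType (α := ℕ × ℕ × (Σ k, Fin k → Finset ℕ)) (fun a => Fin a.2.2.1)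
  | node M n k s c => ⟨(M, n, ⟨k, s⟩), fun i => (c i).toWType⟩

lemma toWType_injective : Function.Injective toWType := by
  intro t
  induction t with
  | node M n k s c ih =>
    rintro ⟨M', n', k', s', c'⟩ h
    simp only [toWType, WType.mk.injEq, Prod.mk.injEq] at h
    obtain ⟨⟨rfl, rfl, h⟩, h'⟩ := h
    cases h
    simp only [heq_eq_eq] at h'
    congr 1
    funext i
    exact ih i (congrFun h' i)

instance : Countable Code := toWType_injective.countable

lemma node_injective (M k s c) : Function.Injective fun n => node M n k s c := by
  intro a b h
  simpa using h

instance : Infinite Code := Infinite.of_injective _ (node_injective 0 0 Fin.elim0 Fin.elim0)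

end Code

/-! ### Truncation of sets and the edge relation -/

/-- The finite set of the elements of `x` below `m`. -/
noncomputable def cut (m : ℕ) (x : Set ℕ) : Finset ℕ :=
  open Classical in (Finset.range m).filter (· ∈ x)

@[simp] lemma mem_cut {m : ℕ} {x : Set ℕ} {j : ℕ} : j ∈ cut m x ↔ j < m ∧ j ∈ x := by
  simp [cut]

lemma cut_eq_iff {m : ℕ} {x y : Set ℕ} : cut m x = cut m y ↔ ∀ j < m, j ∈ x ↔ j ∈ y := by
  simp only [Finset.ext_iff, mem_cut]
  grind

lemma cut_cut {M m : ℕ} (h : m ≤ M) (x : Set ℕ) : cut m (cut M x : Set ℕ) = cut m x := by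
  rw [cut_eq_iff]; intro j hj; simp; omega

lemma cut_eq_of_le {M m : ℕ} (h : m ≤ M) {x y : Set ℕ} (hxy : cut M x = cut M y) :
    cut m x = cut m y := by
  rw [cut_eq_iff] at *; exact fun j hj => hxy j (by omega)

lemma cut_symmDiff_congr {m : ℕ} {x y c d : Set ℕ} (h : cut m x = cut m y)
    (h' : cut m c = cut m d) : cut m (x ∆ c) = cut m (y ∆ d) := by
  rw [cut_eq_iff] at *
  intro j hj
  simp [Set.mem_symmDiff, h j hj, h' j hj]

/-- Codes of left vertices and pairs `(r, x)`, for right vertices, are joined according to the one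
of higher level, or to both if the levels are equal: `r` is joined to its children, and `l`, of
level `M`, to those `(r, x)` for which `r` is a child of `l` with a label agreeing with `x`
below `M`. Children of higher level than their parent are allowed, but give no edges. -/
def Edge (l : Code) (p : Code × Set ℕ) : Prop :=
  (l.level ≤ p.1.level ∧ ∃ i, p.1.child i = l) ∨
    (p.1.level ≤ l.level ∧ ∃ i, l.child i = p.1 ∧ cut l.level (l.label i) = cut l.level p.2)

lemma edge_congr {m : ℕ} {l r : Code} {x y : Set ℕ} (hl : l.level ≤ m) (h : cut m x = cut m y) :
    Edge l (r, x) ↔ Edge l (r, y) := by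
  simp only [Edge, cut_eq_of_le hl h]

/-! ### Extending maps from bounded level to all vertices -/

/-- The data moving the vertices of level at most a bound: a map of left codes, and the map
`(r, x) ↦ (right r x, x ∆ shift r x)` of right vertices. -/
structure LevelMap where
  /-- the map of left codes -/
  left : Code → Code
  /-- the code of the image of a right vertex -/
  right : Code → Set ℕ → Code
  /-- the set by which the second component of a right vertex is translated -/
  shift : Code → Set ℕ → Set ℕ

namespace LevelMap

/-- On the vertices of level at most `m`, the map `D` preserves the bound on levels, depends on `x`
through `cut m x` only, has `D'` as a left inverse, and maps edges to edges. Non-edges are not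
mentioned: they are preserved as soon as `D'` is a homomorphism with left inverse `D`. -/
structure IsHom (m : ℕ) (D D' : LevelMap) : Prop where
  left_level : ∀ l, l.level ≤ m → (D.left l).level ≤ m
  right_level : ∀ r x, r.level ≤ m → (D.right r x).level ≤ m
  right_congr : ∀ r x y, cut m x = cut m y → D.right r x = D.right r y
  shift_congr : ∀ r x y, cut m x = cut m y → D.shift r x = D.shift r y
  left_inv : ∀ l, l.level ≤ m → D'.left (D.left l) = l
  right_inv : ∀ r x, r.level ≤ m → D'.right (D.right r x) (x ∆ D.shift r x) = r
  shift_inv : ∀ r x, r.level ≤ m → D'.shift (D.right r x) (x ∆ D.shift r x) = D.shift r x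
  edge : ∀ l r x, l.level ≤ m → r.level ≤ m → Edge l (r, x) →
    Edge (D.left l) (D.right r x, x ∆ D.shift r x)

variable (m : ℕ) (D D' : LevelMap)

/-- The extension of a level-`m` map to all codes of left vertices (second argument `true`) and to
the codes of right vertices of level above `m` (second argument `false`), by recursion along the
children. A child of level at most `m` of a left code stands for a right vertex, so it is moved
together with its label. The label is translated by a truncation of the shift, which keeps it
finite. -/
noncomputable def extend : Code → Bool → Code
  | .node M n k s c, true =>
    if M ≤ m then D.left (.node M n k s c) else
      .node M n k
        (fun i => if (c i).level ≤ m then s i ∆ cut M (D.shift (c i) (s i)) else s i)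
        (fun i => if (c i).level ≤ m then D.right (c i) (s i) else extend (c i) false)
  | .node M n k s c, false =>
    if M ≤ m then .node M n k s c else .node M n k s (fun i => extend (c i) true)

/-- The extension of a level-`m` map to all right vertices. -/
noncomputable def extendRight (p : Code × Set ℕ) : Code × Set ℕ :=
  if p.1.level ≤ m then (D.right p.1 p.2, p.2 ∆ D.shift p.1 p.2) else (extend m D p.1 false, p.2)

variable {m D D'}

lemma level_extend_of_lt (t : Code) (b : Bool) (ht : m < t.level) :
    (extend m D t b).level = t.level := by
  obtain ⟨M, n, k, s, c⟩ := t
  have : ¬ M ≤ m := not_le.2 ht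
  cases b <;> simp [extend, this]

lemma extend_left {l : Code} (hl : l.level ≤ m) : extend m D l true = D.left l := by
  obtain ⟨M, n, k, s, c⟩ := l
  rw [Code.level_node] at hl
  simp [extend, hl]

namespace IsHom

lemma level_extend_left_le (h : IsHom m D D') {l : Code} (hl : l.level ≤ m) :
    (extend m D l true).level ≤ m := by
  rw [extend_left hl]; exact h.left_level l hl

lemma extend_extend (h : IsHom m D D') (h' : IsHom m D' D) (t : Code) :
    ∀ b, extend m D' (extend m D t b) b = t := by
  induction t with
  | node M n k s c ih =>
    intro b
    by_cases hM : M ≤ m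
    · cases b
      · simp [extend, hM]
      · rw [extend_left (show (Code.node M n k s c).level ≤ m from hM),
          extend_left (h.left_level (Code.node M n k s c) hM), h.left_inv (Code.node M n k s c) hM]
    · have hmM : m ≤ M := by omega
      cases b
      · simp [extend, hM, ih]
      · simp only [extend, hM, if_false, Code.node.injEq, heq_eq_eq, true_and]
        -- Truncating the shift at `M ≥ m` is harmless: `D'` only depends on sets below `m`.
        have key : ∀ i, (c i).level ≤ m →
            cut m ((s i ∆ cut M (D.shift (c i) (s i)) : Finset ℕ) : Set ℕ) =
              cut m ((s i : Set ℕ) ∆ D.shift (c i) (s i)) := by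
          intro i hi
          rw [Finset.coe_symmDiff]
          exact cut_symmDiff_congr rfl (cut_cut hmM _)
        refine ⟨funext fun i => ?_, funext fun i => ?_⟩
        · by_cases hi : (c i).level ≤ m
          · simp only [hi, if_true, h.right_level _ _ hi]
            rw [h'.shift_congr _ _ _ (key i hi), h.shift_inv _ _ hi, symmDiff_symmDiff_cancel_right]
          · simp [hi, level_extend_of_lt (c i) false (not_le.1 hi)]
        · by_cases hi : (c i).level ≤ m
          · simp only [hi, if_true, h.right_level _ _ hi]
            rw [h'.right_congr _ _ _ (key i hi), h.right_inv _ _ hi]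
          · simp [hi, level_extend_of_lt (c i) false (not_le.1 hi), ih]

lemma extendRight_extendRight (h : IsHom m D D') (h' : IsHom m D' D) (p : Code × Set ℕ) :
    extendRight m D' (extendRight m D p) = p := by
  obtain ⟨r, x⟩ := p
  by_cases hr : r.level ≤ m
  · simp [extendRight, hr, h.right_level _ _ hr, h.right_inv _ _ hr, h.shift_inv _ _ hr]
  · simp [extendRight, hr, level_extend_of_lt r false (not_le.1 hr), h.extend_extend h']

lemma edge_extend (h : IsHom m D D') {l : Code} {p : Code × Set ℕ} (hE : Edge l p) :
    Edge (extend m D l true) (extendRight m D p) := by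
  obtain ⟨r, x⟩ := p
  by_cases hr : r.level ≤ m
  · by_cases hl : l.level ≤ m
    · simpa [extendRight, hr, extend_left hl] using h.edge l r x hl hr hE
    · -- The level of `l` exceeds that of `r`, so `r` is a labelled child of `l`.
      rcases hE with ⟨hlr, -⟩ | ⟨-, i, hi, hx⟩
      · simp only at hlr; omega
      have hlev := level_extend_of_lt (D := D) l true (not_le.1 hl)
      have hr' := h.right_level r x hr
      simp only [extendRight, hr, if_true]
      refine Or.inr ⟨by simp only; omega, ?_⟩
      rw [hlev]
      obtain ⟨M, n, k, s, c⟩ := l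
      simp only [Code.level_node] at hl hx hlev ⊢
      simp only [Code.child, Code.label] at hi hx
      rw [extend, if_neg hl]
      refine ⟨i, ?_, ?_⟩
      · simp only [Code.child, hi, hr, if_true]
        exact h.right_congr _ _ _ (cut_eq_of_le (by omega) hx)
      · simp only [Code.label, hi, hr, if_true]
        rw [h.shift_congr r (s i) x (cut_eq_of_le (by omega) hx), Finset.coe_symmDiff]
        exact cut_symmDiff_congr hx (cut_cut le_rfl _)
  · have hrlev := level_extend_of_lt (D := D) r false (not_le.1 hr)
    simp only [extendRight, hr, if_false]
    rcases hE with ⟨hlr, i, hi⟩ | ⟨hrl, i, hi, hx⟩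
    · refine Or.inl ⟨?_, ?_⟩
      · simp only [hrlev]
        by_cases hl : l.level ≤ m
        · have := h.level_extend_left_le hl; omega
        · rw [level_extend_of_lt l true (not_le.1 hl)]; exact hlr
      · obtain ⟨M, n, k, s, c⟩ := r
        simp only [Code.level_node] at hr
        rw [extend, if_neg hr]
        exact ⟨i, congrArg (extend m D · true) hi⟩
    · simp only at hrl hi hx
      have hl : m < l.level := by omega
      have hlev := level_extend_of_lt (D := D) l true hl
      refine Or.inr ⟨by simp only; omega, ?_⟩
      rw [hlev]
      obtain ⟨M, n, k, s, c⟩ := l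
      simp only [Code.level_node] at hl hx hlev hrl ⊢
      simp only [Code.child, Code.label] at hi hx
      rw [extend, if_neg (not_le.2 hl)]
      refine ⟨i, ?_, ?_⟩
      · simp only [Code.child, hi, hr, if_false]
      · simpa only [Code.label, hi, hr, if_false] using hx

end IsHom
end LevelMap

/-! ### Back-and-forth -/

/-- Back-and-forth: if every member of a family of finite relations can be enlarged within the
family so as to relate any given point of the countable set `C`, on either side, then any member
lies in a relation on `C`, total on both sides, all of whose pairs come from the family. -/
theorem exists_backAndForth {V : Type*} {C : Set V} (hC : C.Countable)
    (P : Finset (V × V) → Prop) (f₀ : Finset (V × V)) (h₀ : P f₀)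
    (forth : ∀ f, P f → ∀ v ∈ C, ∃ f', P f' ∧ f ⊆ f' ∧ ∃ w, (v, w) ∈ f')
    (back : ∀ f, P f → ∀ w ∈ C, ∃ f', P f' ∧ f ⊆ f' ∧ ∃ v, (v, w) ∈ f') :
    ∃ F : Set (V × V), ↑f₀ ⊆ F ∧ (∀ p ∈ F, ∀ q ∈ F, ∃ f, P f ∧ p ∈ f ∧ q ∈ f) ∧
      (∀ v ∈ C, ∃ w, (v, w) ∈ F) ∧ ∀ w ∈ C, ∃ v, (v, w) ∈ F := by
  have := hC.to_subtype
  let _ : Encodable (C ⊕ C) := Encodable.ofCountable _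
  let 𝒟 : C ⊕ C → Order.Cofinal {f // P f} := fun i =>
    { carrier := {f | i.elim (fun v => ∃ w, (v.1, w) ∈ f.1) (fun w => ∃ v, (v, w.1) ∈ f.1)}
      isCofinal := by
        rintro ⟨f, hf⟩
        rcases i with v | w
        · obtain ⟨f', hf', hff', hv⟩ := forth f hf v v.2
          exact ⟨⟨f', hf'⟩, hv, hff'⟩
        · obtain ⟨f', hf', hff', hv⟩ := back f hf w w.2
          exact ⟨⟨f', hf'⟩, hv, hff'⟩ }
  let I := Order.idealOfCofinals ⟨f₀, h₀⟩ 𝒟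
  refine ⟨{p | ∃ f ∈ I, p ∈ f.1}, ?_, ?_, ?_, ?_⟩
  · exact fun p hp => ⟨_, Order.mem_idealOfCofinals _ _, hp⟩
  · rintro p ⟨f, hf, hp⟩ q ⟨g, hg, hq⟩
    obtain ⟨k, -, hfk, hgk⟩ := I.directed f hf g hg
    exact ⟨k.1, k.2, hfk hp, hgk hq⟩
  · intro v hv
    obtain ⟨f, ⟨w, hw⟩, hf⟩ := Order.cofinal_meets_idealOfCofinals ⟨f₀, h₀⟩ 𝒟 (Sum.inl ⟨v, hv⟩)
    exact ⟨w, f, hf, hw⟩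
  · intro v hv
    obtain ⟨f, ⟨w, hw⟩, hf⟩ := Order.cofinal_meets_idealOfCofinals ⟨f₀, h₀⟩ 𝒟 (Sum.inr ⟨v, hv⟩)
    exact ⟨w, f, hf, hw⟩

/-! ### Sides and local symmetry -/

namespace BipartiteGraph

lemma isLeft_ne_of_adj {Γ : BipartiteGraph} {u v : Γ.Vertex} (h : Γ.toSimpleGraph.Adj u v) :
    u.isLeft ≠ v.isLeft := by
  rcases u with l | p <;> rcases v with l' | p'
  · exact h.elim
  · simp
  · simp
  · exact h.elim

/-- Homogeneous bipartite graphs are locally symmetric: a vertex and finitely many of its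
neighbours form a star. -/
theorem IsHomogeneous.isLocallySymmetric {Γ : BipartiteGraph}
    (hΓ : Γ.IsHomogeneous) (n : ℕ) : Γ.IsLocallySymmetric n := by
  classical
  refine ⟨Γ.automorphisms, subset_rfl, fun v x y hx hy hvx hvy => ?_⟩
  have hnadj : ∀ {u w : Γ.Vertex}, u.isLeft = w.isLeft → ¬ Γ.toSimpleGraph.Adj u w :=
    fun h h' => isLeft_ne_of_adj h' h
  have hxx : ∀ i j, (x i).isLeft = (x j).isLeft := fun i j => by
    have := isLeft_ne_of_adj (hvx i); have := isLeft_ne_of_adj (hvx j); grind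
  have hyy : ∀ i j, (y i).isLeft = (y j).isLeft := fun i j => by
    have := isLeft_ne_of_adj (hvy i); have := isLeft_ne_of_adj (hvy j); grind
  have hxy : ∀ i, (x i).isLeft = (y i).isLeft := fun i => by
    have := isLeft_ne_of_adj (hvx i); have := isLeft_ne_of_adj (hvy i); grind
  let f : Γ.Vertex → Γ.Vertex := fun u => if h : ∃ i, x i = u then y h.choose else u
  have hfx : ∀ i, f (x i) = y i := by
    intro i
    have h : ∃ j, x j = x i := ⟨i, rfl⟩
    simp only [f, dif_pos h]
    rw [hx h.choose_spec]
  have hfv : f v = v := by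
    have h : ¬ ∃ i, x i = v := fun ⟨i, hi⟩ => (hvx i).ne hi.symm
    simp only [f, dif_neg h]
  have hfl : ∀ u ∈ insert v (Set.range x), u.isLeft = (f u).isLeft := by
    rintro _ (rfl | ⟨i, rfl⟩)
    · rw [hfv]
    · rw [hfx, hxy]
  obtain ⟨g, hg, hgf⟩ := hΓ (insert v (Set.range x)) f ((Set.finite_range x).insert v) {
    injOn := by
      rintro _ (rfl | ⟨i, rfl⟩) _ (rfl | ⟨j, rfl⟩) h
      · rfl
      · rw [hfv, hfx] at h; exact absurd h (hvy j).ne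
      · rw [hfv, hfx] at h; exact absurd h.symm (hvy i).ne
      · rw [hfx, hfx] at h; rw [hy h]
    left := fun u hu hul => (hfl u hu).symm.trans hul
    right := fun u hu hul => by
      rw [← Sum.not_isLeft] at hul ⊢; rwa [← hfl u hu]
    adj_iff := by
      rintro _ (rfl | ⟨i, rfl⟩) _ (rfl | ⟨j, rfl⟩)
      · rw [hfv]
      · rw [hfv, hfx]; exact iff_of_true (hvx j) (hvy j)
      · rw [hfv, hfx]; exact iff_of_true (hvx i).symm (hvy i).symm
      · rw [hfx, hfx]; exact iff_of_false (hnadj (hxx i j)) (hnadj (hyy i j)) }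
  exact ⟨g, hg, (hgf (Set.mem_insert _ _)).trans hfv, fun i =>
    (hgf (Set.mem_insert_of_mem _ ⟨i, rfl⟩)).trans (hfx i)⟩

end BipartiteGraph

/-! ### The graph of codes and its extension property -/

/-- The bipartite graph of codes. -/
def codeGraph : BipartiteGraph.{0} where
  L := Code
  R := Code × Set ℕ
  E := Edge
  nonempty_L := inferInstance
  nonempty_R := inferInstance

namespace codeGraph

open BipartiteGraph

/-- The code of a vertex. -/
def code : codeGraph.Vertex → Code
  | .inl l => l
  | .inr p => p.1

/-- The truncation `(r, x) ↦ (r, x ∩ [0, m))` of right vertices; left vertices are fixed. -/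
noncomputable def trunc (m : ℕ) : codeGraph.Vertex → codeGraph.Vertex
  | .inl l => .inl l
  | .inr p => .inr (p.1, cut m p.2)

/-- The countable set of vertices of level at most `m` fixed by `trunc m`. -/
def core (m : ℕ) : Set codeGraph.Vertex := {v | (code v).level ≤ m ∧ trunc m v = v}

lemma countable_core (m : ℕ) : (core m).Countable := by
  refine ((countable_range (Sum.inl : Code → codeGraph.Vertex)).union (countable_range
    fun p : Code × Finset ℕ => (Sum.inr (p.1, (p.2 : Set ℕ)) : codeGraph.Vertex))).mono ?_
  rintro (l | ⟨r, x⟩) ⟨-, hv⟩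
  · exact Or.inl ⟨l, rfl⟩
  · exact Or.inr ⟨(r, cut m x), hv⟩

@[simp] lemma code_trunc (m v) : code (trunc m v) = code v := by rcases v with l | p <;> rfl

@[simp] lemma isLeft_trunc (m v) : (trunc m v).isLeft = v.isLeft := by rcases v with l | p <;> rfl

lemma trunc_trunc (m v) : trunc m (trunc m v) = trunc m v := by
  rcases v with l | ⟨r, x⟩
  · rfl
  · simp [trunc, cut_cut le_rfl]

lemma trunc_mem_core {m v} (hv : (code v).level ≤ m) : trunc m v ∈ core m :=
  ⟨by rwa [code_trunc], trunc_trunc m v⟩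

lemma adj_trunc {m : ℕ} {v w : codeGraph.Vertex} (hv : (code v).level ≤ m)
    (hw : (code w).level ≤ m) :
    codeGraph.toSimpleGraph.Adj (trunc m v) (trunc m w) ↔ codeGraph.toSimpleGraph.Adj v w := by
  rcases v with l | ⟨r, x⟩ <;> rcases w with l' | ⟨r', x'⟩
  · rfl
  · exact edge_congr hv (cut_cut le_rfl _)
  · exact edge_congr hw (cut_cut le_rfl _)
  · rfl

/-- Finitely many vertices have distinct truncations at all large levels. -/
lemma eventually_trunc (s : Finset codeGraph.Vertex) :
    ∀ᶠ m in Filter.atTop, (∀ v ∈ s, (code v).level ≤ m) ∧ Set.InjOn (trunc m) s := by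
  refine Filter.Eventually.and ?_ ?_
  · rw [Filter.eventually_all_finset]
    exact fun v _ => Filter.eventually_ge_atTop _
  · have : ∀ v ∈ s, ∀ w ∈ s, ∀ᶠ m in Filter.atTop, trunc m v = trunc m w → v = w := by
      intro v _ w _
      by_cases hvw : v = w
      · simp [hvw]
      rcases v with l | ⟨r, x⟩ <;> rcases w with l' | ⟨r', x'⟩
      · exact Filter.Eventually.of_forall fun m h => h
      · exact Filter.Eventually.of_forall fun m h => by cases h
      · exact Filter.Eventually.of_forall fun m h => by cases h
      · by_cases hr : r = r'
        · subst hr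
          have hx : x ≠ x' := fun h => hvw (by rw [h])
          obtain ⟨j, hj⟩ : ∃ j, ¬ (j ∈ x ↔ j ∈ x') := by
            by_contra! h; exact hx (Set.ext h)
          filter_upwards [Filter.eventually_gt_atTop j] with m hm h
          have h' : (cut m x : Set ℕ) = cut m x' := congrArg Prod.snd (Sum.inr.inj h)
          exact absurd (cut_eq_iff.1 (Finset.coe_injective h') j hm) hj
        · exact Filter.Eventually.of_forall fun m h =>
            absurd (congrArg Prod.fst (Sum.inr.inj h)) hr
    have h2 := (Filter.eventually_all_finset s).2 fun v hv =>
      (Filter.eventually_all_finset s).2 fun w hw => this v hv w hw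
    filter_upwards [h2] with m hm v hv w hw h using hm v hv w hw h

/-- Any finite set of codes is avoided by some node of level `m` whose children are the codes of the
members of `A`, each right vertex `(r, x)` being labelled by `cut m x`. -/
lemma exists_node (m : ℕ) (A : Finset codeGraph.Vertex) (B : Set Code) (hB : B.Finite) :
    ∃ t : Code, t ∉ B ∧ t.level = m ∧ ∀ r z, (∃ i, t.child i = r ∧ t.label i = z) ↔
      ∃ v ∈ A, code v = r ∧ (match v with | .inl _ => ∅ | .inr p => cut m p.2) = z := by
  let e := A.equivFin.symm
  let lab : codeGraph.Vertex → Finset ℕ := fun v => match v with | .inl _ => ∅ | .inr p => cut m p.2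
  obtain ⟨_, ⟨n, rfl⟩, hn⟩ := (Set.infinite_range_of_injective (Code.node_injective m A.card
    (fun i => lab (e i)) (fun i => code (e i)))).exists_notMem_finite hB
  refine ⟨_, hn, rfl, fun r z => ⟨?_, ?_⟩⟩
  · rintro ⟨i, h⟩
    exact ⟨e i, (e i).2, h⟩
  · rintro ⟨v, hv, h⟩
    refine ⟨e.symm ⟨v, hv⟩, ?_⟩
    simpa [Code.child, Code.label, lab] using h

/-- The extension property within a core; see `exists_extension` for the whole graph. -/
lemma exists_core_extension (m : ℕ) (b : Bool) (F A : Finset codeGraph.Vertex)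
    (hF : ↑F ⊆ core m) (hA : A ⊆ F) :
    ∃ w ∈ core m, w ∉ F ∧ w.isLeft = b ∧
      ∀ u ∈ F, u.isLeft ≠ b → (codeGraph.toSimpleGraph.Adj w u ↔ u ∈ A) := by
  classical
  -- The new vertex must be neither in `F` nor a child of a member of `F`.
  have hB : (⋃ v ∈ F, insert (code v) (Set.range (code v).child)).Finite :=
    F.finite_toSet.biUnion fun v _ => (Set.finite_range _).insert _
  obtain ⟨t, ht, htm, hc⟩ := exists_node m {v ∈ A | v.isLeft ≠ b} _ hB
  simp only [mem_iUnion, not_exists, Set.mem_insert_iff, not_or, mem_range] at ht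
  cases b
  · refine ⟨.inr (t, ∅), ⟨htm.le, ?_⟩, fun h => (ht _ h).1 rfl, rfl, ?_⟩
    · simp [trunc, cut]
    · rintro (l | ⟨r, x⟩) hu hl
      · have hlm : l.level ≤ m := (hF hu).1
        change Edge l (t, ∅) ↔ _
        have := hc l ∅
        constructor
        · rintro (⟨-, i, hi⟩ | ⟨-, i, hi, -⟩)
          · obtain ⟨v, hv, hvl, -⟩ := (hc l _).1 ⟨i, hi, rfl⟩
            rcases v with l' | p
            · cases hvl; exact (Finset.mem_filter.1 hv).1
            · simp at hv
          · exact absurd hi ((ht _ hu).2 i)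
        · intro h
          obtain ⟨i, hi, -⟩ := (hc l ∅).2 ⟨.inl l,
            Finset.mem_filter.2 ⟨h, hl⟩, rfl, rfl⟩
          exact Or.inl ⟨by simp only; omega, i, hi⟩
      · exact absurd rfl hl
  · refine ⟨.inl t, ⟨htm.le, rfl⟩, fun h => (ht _ h).1 rfl, rfl, ?_⟩
    rintro (l | ⟨r, x⟩) hu hl
    · simp at hl
    · have hrm : r.level ≤ m := (hF hu).1
      have hx : (cut m x : Set ℕ) = x := congrArg (fun v : codeGraph.Vertex =>
        v.elim (fun _ => ∅) Prod.snd) (hF hu).2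
      change Edge t (r, x) ↔ _
      constructor
      · rintro (⟨-, i, hi⟩ | ⟨-, i, hi, hxi⟩)
        · exact absurd hi ((ht _ hu).2 i)
        · obtain ⟨v, hv, hvl, hvz⟩ := (hc r _).1 ⟨i, hi, rfl⟩
          rcases v with l' | ⟨r', x'⟩
          · simp at hv
          · cases hvl
            have hv' := (Finset.mem_filter.1 hv).1
            have hx' : (cut m x' : Set ℕ) = x' := congrArg (fun v : codeGraph.Vertex =>
              v.elim (fun _ => ∅) Prod.snd) (hF (hA hv')).2
            simp only at hvz hxi
            rw [← hvz, htm, cut_cut le_rfl] at hxi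
            rw [← hx', hxi, hx] at hv'
            exact hv'
      · intro h
        obtain ⟨i, hi, hz⟩ := (hc r (cut m x)).2 ⟨.inr (r, x),
          Finset.mem_filter.2 ⟨h, hl⟩, rfl, rfl⟩
        exact Or.inr ⟨by simp only; omega, i, hi, by rw [hz, hx]⟩

/-- The extension property: any finite set `F` of vertices and `A ⊆ F` admit a vertex outside `F`,
on a prescribed side, whose neighbours among the members of `F` on the other side are exactly
those in `A`. -/
lemma exists_extension (b : Bool) (F A : Finset codeGraph.Vertex) (hA : A ⊆ F) :
    ∃ w ∉ F, w.isLeft = b ∧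
      ∀ u ∈ F, u.isLeft ≠ b → (codeGraph.toSimpleGraph.Adj w u ↔ u ∈ A) := by
  classical
  obtain ⟨m, hm, hinj⟩ := (eventually_trunc F).exists
  obtain ⟨w, hwC, hwF, hwb, hw⟩ := exists_core_extension m b (F.image (trunc m))
    (A.image (trunc m)) (by
      rw [Finset.coe_image]
      rintro _ ⟨v, hv, rfl⟩
      exact trunc_mem_core (hm v hv)) (Finset.image_subset_image hA)
  refine ⟨w, fun h => hwF ?_, hwb, fun u hu hub => ?_⟩
  · rw [← hwC.2]; exact Finset.mem_image_of_mem _ h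
  · rw [← adj_trunc hwC.1 (hm u hu), hwC.2,
      hw _ (Finset.mem_image_of_mem _ hu) (by rwa [isLeft_trunc]), Finset.mem_image]
    constructor
    · rintro ⟨v, hv, hvu⟩
      rwa [← hinj (hA hv) hu hvu]
    · exact fun h => ⟨u, h, rfl⟩

/-! ### Automorphisms of a core -/

/-- A finite relation that is the graph of a partial automorphism of the level-`m` core. -/
def IsCoreIso (m : ℕ) (f : Finset (codeGraph.Vertex × codeGraph.Vertex)) : Prop :=
  ∀ p ∈ f, p.1 ∈ core m ∧ p.2 ∈ core m ∧ p.1.isLeft = p.2.isLeft ∧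
    ∀ q ∈ f, (p.1 = q.1 ↔ p.2 = q.2) ∧
      (codeGraph.toSimpleGraph.Adj p.1 q.1 ↔ codeGraph.toSimpleGraph.Adj p.2 q.2)

lemma IsCoreIso.forth {m f} (hf : IsCoreIso m f) {v : codeGraph.Vertex} (hv : v ∈ core m) :
    ∃ f', IsCoreIso m f' ∧ f ⊆ f' ∧ ∃ w, (v, w) ∈ f' := by
  classical
  by_cases hvf : ∃ w, (v, w) ∈ f
  · exact ⟨f, hf, subset_rfl, hvf⟩
  obtain ⟨w, hwC, hwf, hwv, hw⟩ := exists_core_extension m v.isLeft (f.image Prod.snd)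
    ({p ∈ f | codeGraph.toSimpleGraph.Adj v p.1}.image Prod.snd)
    (by
      rw [Finset.coe_image]
      rintro _ ⟨p, hp, rfl⟩
      exact (hf p hp).2.1)
    (Finset.image_subset_image (Finset.filter_subset _ _))
  have hadj : ∀ q ∈ f, codeGraph.toSimpleGraph.Adj v q.1 ↔ codeGraph.toSimpleGraph.Adj w q.2 := by
    intro q hq
    by_cases hqv : q.2.isLeft = v.isLeft
    · refine iff_of_false (fun h => isLeft_ne_of_adj h ?_) (fun h => isLeft_ne_of_adj h ?_)
      · rw [(hf q hq).2.2.1, hqv]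
      · rw [hwv, hqv]
    · rw [hw _ (Finset.mem_image_of_mem _ hq) hqv, Finset.mem_image]
      constructor
      · exact fun h => ⟨q, Finset.mem_filter.2 ⟨hq, h⟩, rfl⟩
      · rintro ⟨p, hp, hpq⟩
        rw [Finset.mem_filter] at hp
        rw [← ((hf p hp.1).2.2.2 q hq).1.2 hpq]
        exact hp.2
  have hne : ∀ q ∈ f, v ≠ q.1 ∧ w ≠ q.2 := fun q hq =>
    ⟨fun h => hvf ⟨q.2, h ▸ hq⟩, fun h => hwf (h ▸ Finset.mem_image_of_mem _ hq)⟩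
  refine ⟨insert (v, w) f, ?_, Finset.subset_insert _ _, w, Finset.mem_insert_self _ _⟩
  intro p hp
  rcases Finset.mem_insert.1 hp with rfl | hp
  · refine ⟨hv, hwC, hwv.symm, fun q hq => ?_⟩
    rcases Finset.mem_insert.1 hq with rfl | hq
    · simp
    · exact ⟨iff_of_false (hne q hq).1 (hne q hq).2, hadj q hq⟩
  · refine ⟨(hf p hp).1, (hf p hp).2.1, (hf p hp).2.2.1, fun q hq => ?_⟩
    rcases Finset.mem_insert.1 hq with rfl | hq
    · refine ⟨iff_of_false (hne p hp).1.symm (hne p hp).2.symm, ?_⟩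
      rw [SimpleGraph.adj_comm, hadj p hp, SimpleGraph.adj_comm]
    · exact (hf p hp).2.2.2 q hq

open Classical in
lemma IsCoreIso.swap {m f} (hf : IsCoreIso m f) : IsCoreIso m (f.image Prod.swap) := by
  intro _ hp'
  obtain ⟨p, hp, rfl⟩ := Finset.mem_image.1 hp'
  obtain ⟨h1, h2, h3, h4⟩ := hf p hp
  refine ⟨h2, h1, h3.symm, fun _ hq' => ?_⟩
  obtain ⟨q, hq, rfl⟩ := Finset.mem_image.1 hq'
  exact ⟨(h4 q hq).1.symm, (h4 q hq).2.symm⟩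

lemma IsCoreIso.back {m f} (hf : IsCoreIso m f) {w : codeGraph.Vertex} (hw : w ∈ core m) :
    ∃ f', IsCoreIso m f' ∧ f ⊆ f' ∧ ∃ v, (v, w) ∈ f' := by
  classical
  obtain ⟨f', hf', hff', v, hv⟩ := hf.swap.forth hw
  refine ⟨f'.image Prod.swap, hf'.swap, fun p hp => ?_, v, Finset.mem_image.2 ⟨_, hv, rfl⟩⟩
  exact Finset.mem_image.2 ⟨p.swap, hff' (Finset.mem_image_of_mem _ hp), p.swap_swap⟩

variable {m : ℕ} {F : Set (codeGraph.Vertex × codeGraph.Vertex)}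

/-- The relation `F` is the graph of an automorphism of the level-`m` core. It is described through
its finite parts, as back-and-forth produces it. -/
structure IsCoreAut (m : ℕ) (F : Set (codeGraph.Vertex × codeGraph.Vertex)) : Prop where
  iso : ∀ p ∈ F, ∀ q ∈ F, ∃ f, IsCoreIso m f ∧ p ∈ f ∧ q ∈ f
  dom : ∀ v ∈ core m, ∃ w, (v, w) ∈ F
  rng : ∀ w ∈ core m, ∃ v, (v, w) ∈ F

lemma IsCoreAut.swap (hF : IsCoreAut m F) : IsCoreAut m (Prod.swap ⁻¹' F) where
  iso p hp q hq := by
    classical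
    obtain ⟨f, hf, h1, h2⟩ := hF.iso _ hp _ hq
    exact ⟨_, hf.swap, Finset.mem_image.2 ⟨_, h1, p.swap_swap⟩,
      Finset.mem_image.2 ⟨_, h2, q.swap_swap⟩⟩
  dom := hF.rng
  rng := hF.dom

lemma IsCoreAut.eq_iff (hF : IsCoreAut m F) {p q} (hp : p ∈ F) (hq : q ∈ F) :
    p.1 = q.1 ↔ p.2 = q.2 := by
  obtain ⟨f, hf, h1, h2⟩ := hF.iso _ hp _ hq
  exact ((hf p h1).2.2.2 q h2).1

lemma IsCoreAut.adj_iff (hF : IsCoreAut m F) {p q} (hp : p ∈ F) (hq : q ∈ F) :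
    codeGraph.toSimpleGraph.Adj p.1 q.1 ↔ codeGraph.toSimpleGraph.Adj p.2 q.2 := by
  obtain ⟨f, hf, h1, h2⟩ := hF.iso _ hp _ hq
  exact ((hf p h1).2.2.2 q h2).2

lemma IsCoreAut.mem (hF : IsCoreAut m F) {p} (hp : p ∈ F) :
    p.1 ∈ core m ∧ p.2 ∈ core m ∧ p.1.isLeft = p.2.isLeft := by
  obtain ⟨f, hf, h1, -⟩ := hF.iso _ hp _ hp
  exact ⟨(hf p h1).1, (hf p h1).2.1, (hf p h1).2.2.1⟩

lemma IsCoreAut.exists_left (hF : IsCoreAut m F) {l : Code} (hl : l.level ≤ m) :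
    ∃ l' : Code, ((.inl l, .inl l') : _ × _) ∈ F := by
  obtain ⟨w, hw⟩ := hF.dom (.inl l) ⟨hl, rfl⟩
  rcases w with l' | p
  · exact ⟨l', hw⟩
  · exact absurd (hF.mem hw).2.2 Bool.noConfusion

lemma IsCoreAut.exists_right (hF : IsCoreAut m F) {r : Code} (hr : r.level ≤ m) (x : Set ℕ) :
    ∃ (r' : Code) (y : Set ℕ),
      ((trunc m (.inr (r, x)), trunc m (.inr (r', y))) : _ × _) ∈ F := by
  obtain ⟨w, hw⟩ := hF.dom (trunc m (.inr (r, x))) (trunc_mem_core hr)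
  rcases w with l' | ⟨r', y⟩
  · exact absurd (hF.mem hw).2.2 Bool.noConfusion
  · refine ⟨r', y, ?_⟩
    rw [(hF.mem hw).2.1.2]; exact hw

lemma trunc_inr_eq_iff {r r' : Code} {x x' : Set ℕ} :
    trunc m (.inr (r, x)) = trunc m (.inr (r', x')) ↔ r = r' ∧ cut m x = cut m x' := by
  constructor
  · intro h
    have := Sum.inr.inj h
    exact ⟨congrArg Prod.fst this, Finset.coe_injective (congrArg Prod.snd this)⟩
  · rintro ⟨rfl, h⟩
    simp only [trunc, h]

/-! ### Lifting automorphisms of a core -/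

/-- The level map `D` lifts the relation `F` on the level-`m` core: `F` relates each left vertex of
level at most `m` to its image, and the truncation of each such right vertex to that of its
image. -/
structure Realizes (m : ℕ) (F : Set (codeGraph.Vertex × codeGraph.Vertex)) (D : LevelMap) :
    Prop where
  left : ∀ l : Code, l.level ≤ m → ((.inl l, .inl (D.left l)) : _ × _) ∈ F
  right : ∀ (r : Code) (x : Set ℕ), r.level ≤ m →
    ((trunc m (.inr (r, x)), trunc m (.inr (D.right r x, x ∆ D.shift r x))) : _ × _) ∈ F
  right_congr : ∀ r x y, cut m x = cut m y → D.right r x = D.right r y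
  shift_congr : ∀ r x y, cut m x = cut m y → D.shift r x = D.shift r y

/-- Level maps lifting an automorphism of the core and its inverse are inverse to each other as soon
as their shifts are. -/
lemma Realizes.isHom (hF : IsCoreAut m F) {D D' : LevelMap} (hD : Realizes m F D)
    (hD' : Realizes m (Prod.swap ⁻¹' F) D')
    (hs : ∀ r x, r.level ≤ m → D'.shift (D.right r x) (x ∆ D.shift r x) = D.shift r x) :
    D.IsHom m D' where
  left_level l hl := (hF.mem (hD.left l hl)).2.1.1
  right_level r x hr := (hF.mem (hD.right r x hr)).2.1.1
  right_congr := hD.right_congr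
  shift_congr := hD.shift_congr
  left_inv l hl := by
    have h1 := hD.left l hl
    have h2 := hD'.left (D.left l) (hF.mem h1).2.1.1
    exact (Sum.inl.inj ((hF.eq_iff h1 h2).2 rfl)).symm
  right_inv r x hr := by
    have h1 := hD.right r x hr
    have h2 := hD'.right (D.right r x) (x ∆ D.shift r x) (hF.mem h1).2.1.1
    exact (trunc_inr_eq_iff.1 ((hF.eq_iff h1 h2).2 rfl)).1.symm
  shift_inv := hs
  edge l r x hl hr hE := by
    have h1 := hD.left l hl
    have h2 := hD.right r x hr
    have h3 : codeGraph.toSimpleGraph.Adj (trunc m (.inl l)) (trunc m (.inr (r, x))) :=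
      (adj_trunc (v := .inl l) (w := .inr (r, x)) hl hr).2 hE
    exact (adj_trunc (v := .inl (D.left l)) (w := .inr (D.right r x, x ∆ D.shift r x))
      (hF.mem h1).2.1.1 (hF.mem h2).2.1.1).1 ((hF.adj_iff h1 h2).1 h3)

/-- An automorphism of the core lifts to a level map with a homomorphism as inverse. The lift can be
chosen to agree with `f` on `s`, if the truncations of the members of `s` are distinct and mapped
by `F` as `f` demands. -/
lemma IsCoreAut.exists_realizes (hF : IsCoreAut m F) (s : Set codeGraph.Vertex)
    (f : codeGraph.Vertex → codeGraph.Vertex) (hs : ∀ v ∈ s, (code v).level ≤ m)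
    (hinj : Set.InjOn (trunc m) s) (hside : ∀ v ∈ s, v.isLeft = (f v).isLeft)
    (hsF : ∀ v ∈ s, (trunc m v, trunc m (f v)) ∈ F) :
    ∃ D D' : LevelMap, D.IsHom m D' ∧ D'.IsHom m D ∧
      (∀ l : Code, .inl l ∈ s → f (.inl l) = .inl (D.left l)) ∧
      ∀ (r : Code) (x : Set ℕ), .inr (r, x) ∈ s →
        f (.inr (r, x)) = .inr (D.right r x, x ∆ D.shift r x) := by
  have hleft : ∀ l : Code, ∃ l' : Code, l.level ≤ m → ((.inl l, .inl l') : _ × _) ∈ F := by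
    intro l
    by_cases hl : l.level ≤ m
    · exact (hF.exists_left hl).imp fun _ h _ => h
    · exact ⟨l, fun h => absurd h hl⟩
  have hleft' : ∀ l : Code, ∃ l' : Code, l.level ≤ m → ((.inl l', .inl l) : _ × _) ∈ F := by
    intro l
    by_cases hl : l.level ≤ m
    · exact (hF.swap.exists_left hl).imp fun _ h _ => h
    · exact ⟨l, fun h => absurd h hl⟩
  -- `x ∆ y` is the translation taking `x` to `y`.
  have hright : ∀ (r : Code) (t : Finset ℕ), ∃ (r' : Code) (c : Set ℕ), r.level ≤ m →
      ((trunc m (.inr (r, t)), trunc m (.inr (r', t ∆ c))) : _ × _) ∈ F ∧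
      ∀ (x : Set ℕ), .inr (r, x) ∈ s → cut m x = cut m t → f (.inr (r, x)) = .inr (r', x ∆ c) := by
    intro r t
    by_cases hr : r.level ≤ m
    · by_cases hx : ∃ x : Set ℕ, (.inr (r, x) : codeGraph.Vertex) ∈ s ∧ cut m x = cut m t
      · obtain ⟨x, hxs, hxt⟩ := hx
        have h1 := hsF _ hxs
        have h2 := hside _ hxs
        rcases hf : f (.inr (r, x)) with l | ⟨r', y⟩
        · rw [hf] at h2; cases h2
        rw [hf] at h1
        refine ⟨r', x ∆ y, fun _ => ⟨?_, fun x' hx's hx't => ?_⟩⟩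
        · convert h1 using 2
          · rw [trunc_inr_eq_iff]; exact ⟨rfl, hxt.symm⟩
          · rw [trunc_inr_eq_iff]
            refine ⟨rfl, ?_⟩
            rw [cut_symmDiff_congr hxt.symm (rfl : cut m (x ∆ y) = _),
              symmDiff_symmDiff_cancel_left]
        · have : x' = x := congrArg Prod.snd (Sum.inr.inj (hinj hx's hxs
            (trunc_inr_eq_iff.2 ⟨rfl, hx't.trans hxt.symm⟩)))
          rw [this, hf, symmDiff_symmDiff_cancel_left]
      · obtain ⟨r', y, h⟩ := hF.exists_right hr t
        refine ⟨r', t ∆ y, fun _ => ⟨?_, fun x hxs hxt => absurd ⟨x, hxs, hxt⟩ hx⟩⟩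
        rwa [symmDiff_symmDiff_cancel_left]
    · exact ⟨r, ∅, fun h => absurd h hr⟩
  have hright' : ∀ (r : Code) (t : Finset ℕ), ∃ (r' : Code) (y : Set ℕ), r.level ≤ m →
      ((trunc m (.inr (r', y)), trunc m (.inr (r, t))) : _ × _) ∈ F := by
    intro r t
    by_cases hr : r.level ≤ m
    · obtain ⟨r', y, h⟩ := hF.swap.exists_right hr t
      exact ⟨r', y, fun _ => h⟩
    · exact ⟨r, ∅, fun h => absurd h hr⟩
  choose a ha using hleft
  choose a' ha' using hleft'
  choose b c hbc using hright
  choose b' y' hb' using hright'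
  let D : LevelMap := ⟨a, fun r x => b r (cut m x), fun r x => c r (cut m x)⟩
  -- The inverse translates by the same sets.
  let D' : LevelMap := ⟨a', fun r x => b' r (cut m x),
    fun r x => c (b' r (cut m x)) (cut m (y' r (cut m x)))⟩
  have hcut : ∀ x d : Set ℕ, cut m ((cut m x : Set ℕ) ∆ d) = cut m (x ∆ d) := fun x d =>
    cut_symmDiff_congr (cut_cut le_rfl x) rfl
  have hD : Realizes m F D :=
    { left := ha
      right := fun r x hr => by
        convert (hbc r (cut m x) hr).1 using 2
        · exact trunc_inr_eq_iff.2 ⟨rfl, (cut_cut le_rfl x).symm⟩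
        · exact trunc_inr_eq_iff.2 ⟨rfl, (hcut x _).symm⟩
      right_congr := fun r x y h => by simp only [D, h]
      shift_congr := fun r x y h => by simp only [D, h] }
  have hinv : ∀ r x, r.level ≤ m →
      ((trunc m (.inr (b' r (cut m x), y' r (cut m x))), trunc m (.inr (r, x))) : _ × _) ∈ F := by
    intro r x hr
    convert hb' r (cut m x) hr using 2
    exact trunc_inr_eq_iff.2 ⟨rfl, (cut_cut le_rfl x).symm⟩
  -- Up to truncation, shifting by `D'.shift r x` recovers the preimage of `(r, x)`.
  have hback : ∀ r x, r.level ≤ m →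
      D.right (D'.right r x) (y' r (cut m x)) = r ∧
      cut m (x ∆ D'.shift r x) = cut m (y' r (cut m x)) := by
    intro r x hr
    have h1 := hinv r x hr
    have h2 := hD.right (b' r (cut m x)) (y' r (cut m x)) (hF.mem h1).1.1
    obtain ⟨h3, h4⟩ := trunc_inr_eq_iff.1 ((hF.eq_iff h1 h2).1 rfl)
    refine ⟨h3.symm, ?_⟩
    rw [cut_symmDiff_congr h4 (rfl : cut m (D'.shift r x) = _)]
    exact congrArg _ (symmDiff_symmDiff_cancel_right _ _)
  have hD' : Realizes m (Prod.swap ⁻¹' F) D' :=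
    { left := ha'
      right := fun r x hr => by
        change (trunc m (.inr (_, _)), trunc m (.inr (r, x))) ∈ F
        convert hinv r x hr using 2
        exact trunc_inr_eq_iff.2 ⟨rfl, (hback r x hr).2⟩
      right_congr := fun r x y h => by simp only [D', h]
      shift_congr := fun r x y h => by simp only [D', h] }
  refine ⟨D, D', hD.isHom hF hD' ?_, hD'.isHom hF.swap hD ?_, ?_, ?_⟩
  · intro r x hr
    have h1 := hD.right r x hr
    have h2 := hinv (D.right r x) (x ∆ D.shift r x) (hF.mem h1).2.1.1
    obtain ⟨h3, h4⟩ := trunc_inr_eq_iff.1 ((hF.eq_iff h1 h2).2 rfl)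
    change c _ _ = c _ _
    rw [← h3, ← h4]
  · intro r x hr
    have h := (hback r x hr).2
    change c _ (cut m (x ∆ D'.shift r x)) = c _ _
    rw [h]
  · intro l hl
    have h1 := hsF _ hl
    have h2 := hside _ hl
    rcases hf : f (.inl l) with l' | p
    · rw [hf] at h1
      exact (hF.eq_iff h1 (ha l (hs _ hl))).1 rfl
    · rw [hf] at h2; cases h2
  · intro r x hx
    exact (hbc r (cut m x) (hs _ hx)).2 x hx (cut_cut le_rfl x).symm

/-- A level-`m` automorphism extends to an automorphism of the whole graph. -/
lemma exists_automorphism {D D' : LevelMap} (h : D.IsHom m D') (h' : D'.IsHom m D) :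
    ∃ g ∈ codeGraph.automorphisms,
      (∀ l : Code, l.level ≤ m → g (.inl l) = .inl (D.left l)) ∧
      ∀ (r : Code) (x : Set ℕ), r.level ≤ m →
        g (.inr (r, x)) = .inr (D.right r x, x ∆ D.shift r x) := by
  let gL : Code ≃ Code :=
    ⟨(D.extend m · true), (D'.extend m · true), (h.extend_extend h' · true),
      (h'.extend_extend h · true)⟩
  let gR : Code × Set ℕ ≃ Code × Set ℕ :=
    ⟨D.extendRight m, D'.extendRight m, h.extendRight_extendRight h',
      h'.extendRight_extendRight h⟩
  have hE : ∀ l p, Edge l p ↔ Edge (gL l) (gR p) := by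
    intro l p
    refine ⟨h.edge_extend, fun hlp => ?_⟩
    have := h'.edge_extend hlp
    rwa [show D'.extend m (gL l) true = l from gL.symm_apply_apply l,
      show D'.extendRight m (gR p) = p from gR.symm_apply_apply p] at this
  refine ⟨Equiv.sumCongr gL gR, ⟨(Equiv.injective _).injOn, ?_, ?_, ?_⟩, ?_, ?_⟩
  · rintro (l | p) - hl
    · rfl
    · cases hl
  · rintro (l | p) - hl
    · cases hl
    · rfl
  · rintro (l | p) - (l' | p') -
    · rfl
    · exact hE l p'
    · exact hE l' p
    · rfl
  · exact fun l hl => congrArg Sum.inl (LevelMap.extend_left hl)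
  · exact fun r x hr => congrArg Sum.inr (if_pos hr)

/-! ### Homogeneity and the remaining properties -/

theorem isHomogeneous : codeGraph.IsHomogeneous := by
  classical
  intro s f hs hf
  have hside : ∀ v ∈ s, v.isLeft = (f v).isLeft := by
    intro v hv
    have h1 := hf.left v hv
    have h2 := hf.right v hv
    rcases v with l | p
    · exact (h1 rfl).symm
    · simpa using h2 rfl
  obtain ⟨m, ⟨hm, hinj⟩, hm', hinj'⟩ :=
    ((eventually_trunc hs.toFinset).and (eventually_trunc (hs.toFinset.image f))).exists
  simp only [Set.Finite.mem_toFinset, Finset.mem_image, Set.Finite.coe_toFinset,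
    Finset.coe_image, forall_exists_index, and_imp, forall_apply_eq_imp_iff₂] at hm hinj hm' hinj'
  let f₀ := hs.toFinset.image fun v => (trunc m v, trunc m (f v))
  have hf₀ : IsCoreIso m f₀ := by
    intro p hp
    obtain ⟨v, hv, rfl⟩ := Finset.mem_image.1 hp
    rw [Set.Finite.mem_toFinset] at hv
    refine ⟨trunc_mem_core (hm v hv), trunc_mem_core (hm' v hv), ?_, fun q hq => ?_⟩
    · simp only [isLeft_trunc]; exact hside v hv
    · obtain ⟨w, hw, rfl⟩ := Finset.mem_image.1 hq
      rw [Set.Finite.mem_toFinset] at hw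
      refine ⟨?_, ?_⟩
      · simp only
        rw [hinj.eq_iff hv hw, hinj'.eq_iff (mem_image_of_mem f hv) (mem_image_of_mem f hw),
          hf.injOn.eq_iff hv hw]
      · simp only
        rw [adj_trunc (hm v hv) (hm w hw), adj_trunc (hm' v hv) (hm' w hw)]
        exact hf.adj_iff v hv w hw
  obtain ⟨F, hfF, hiso, hdom, hrng⟩ := exists_backAndForth (countable_core m) (IsCoreIso m) f₀ hf₀
    (fun f hf v hv => hf.forth hv) (fun f hf v hv => hf.back hv)
  have hF : IsCoreAut m F := ⟨hiso, hdom, hrng⟩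
  obtain ⟨D, D', h, h', hl, hr⟩ := hF.exists_realizes s f hm hinj hside fun v hv =>
    hfF (Finset.mem_coe.2 (Finset.mem_image_of_mem _ (hs.mem_toFinset.2 hv)))
  obtain ⟨g, hg, hgl, hgr⟩ := exists_automorphism h h'
  refine ⟨g, hg, ?_⟩
  rintro (l | ⟨r, x⟩) hv
  · rw [hl l hv, hgl l (hm _ hv)]
  · rw [hr r x hv, hgr r x (hm _ hv)]

lemma exists_common_neighbor {u v : codeGraph.Vertex} (h : u.isLeft = v.isLeft)
    (B : Finset codeGraph.Vertex) :
    ∃ w ∉ B, codeGraph.toSimpleGraph.Adj w u ∧ codeGraph.toSimpleGraph.Adj w v := by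
  classical
  obtain ⟨w, hwF, hwb, hw⟩ := exists_extension (!u.isLeft) ({u, v} ∪ B) {u, v}
    Finset.subset_union_left
  refine ⟨w, fun h => hwF (Finset.mem_union_right _ h), ?_, ?_⟩
  · exact (hw u (by simp) (Bool.not_ne_self _).symm).2 (by simp)
  · exact (hw v (by simp) (h ▸ (Bool.not_ne_self _).symm)).2 (by simp)

theorem connected : codeGraph.toSimpleGraph.Connected := by
  have key : ∀ u v : codeGraph.Vertex, u.isLeft = v.isLeft →
      codeGraph.toSimpleGraph.Reachable u v := by
    intro u v h
    obtain ⟨w, -, hu, hv⟩ := exists_common_neighbor h ∅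
    exact hu.symm.reachable.trans hv.reachable
  have : Nonempty codeGraph.Vertex := ⟨.inl (Classical.arbitrary Code)⟩
  refine ⟨fun u v => ?_⟩
  by_cases h : u.isLeft = v.isLeft
  · exact key u v h
  · obtain ⟨w, -, hw, -⟩ := exists_common_neighbor (u := u) rfl ∅
    refine hw.symm.reachable.trans (key w v ?_)
    have := isLeft_ne_of_adj hw
    grind

theorem egirth_eq : codeGraph.toSimpleGraph.egirth = 4 := by
  classical
  refine le_antisymm ?_ ?_
  · obtain ⟨v, -, hv⟩ := exists_extension true ∅ ∅ subset_rfl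
    obtain ⟨u, hu, hub, -⟩ := exists_extension true {v} ∅ (by simp)
    have huv : u ≠ v := by simpa using hu
    obtain ⟨w, -, hwu, hwv⟩ := exists_common_neighbor (hub.trans hv.1.symm) ∅
    obtain ⟨z, hz, hzu, hzv⟩ := exists_common_neighbor (hub.trans hv.1.symm) {w}
    have hzw : z ≠ w := by simpa using hz
    let p : codeGraph.toSimpleGraph.Walk u u := .cons hwu.symm (.cons hwv (.cons hzv.symm
      (.cons hzu .nil)))
    have hp : p.IsCycle := by
      have h1 := hwu.ne
      have h2 := hwv.ne
      have h3 := hzu.ne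
      have h4 := hzv.ne
      simp only [p, SimpleGraph.Walk.cons_isCycle_iff, SimpleGraph.Walk.cons_isPath_iff]
      simp [h1, h2, h3, huv, h1.symm, h3.symm, h4.symm, huv.symm, hzw.symm]
    exact SimpleGraph.egirth_le_length hp
  · rw [SimpleGraph.le_egirth]
    intro a w hw
    have h3 := hw.three_le_length
    let C : codeGraph.toSimpleGraph.Coloring Bool :=
      SimpleGraph.Coloring.mk Sum.isLeft fun h => isLeft_ne_of_adj h
    have := (C.even_length_iff_congr w).2 Iff.rfl
    have : 4 ≤ w.length := by
      rcases this with ⟨k, hk⟩; omega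
    exact_mod_cast this

open Cardinal in
theorem isSaS : codeGraph.IsSaS aleph0 (2 ^ aleph0) where
  card_L := mk_eq_aleph0 Code
  card_R := by
    change #(Code × Set ℕ) = _
    rw [mk_prod, lift_id, lift_id, mk_set, mk_eq_aleph0 Code, mk_eq_aleph0 ℕ]
    exact mul_eq_right (cantor _).le (cantor _).le aleph0_ne_zero
  lt := cantor _
  homogeneous := isHomogeneous
  not_complete h := by
    obtain ⟨v, -, hv, -⟩ := exists_extension true ∅ ∅ subset_rfl
    obtain ⟨w, -, hw, hwv⟩ := exists_extension false {v} ∅ (by simp)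
    rcases v with l | p
    · rcases w with l' | p
      · simp at hw
      · exact absurd ((hwv (.inl l) (by simp) (by simp)).1 (h l p)) (by simp)
    · simp at hv
  not_empty h := by
    obtain ⟨v, -, hv, -⟩ := exists_extension true ∅ ∅ subset_rfl
    obtain ⟨w, -, hw, -⟩ := exists_common_neighbor (u := v) rfl ∅
    rcases v with l | p <;> rcases w with l' | p'
    · exact hw
    · exact h _ _ hw
    · exact h _ _ hw
    · exact hw

end codeGraph

theorem theorem1p5 :
    ∃ Γ : BipartiteGraph.{0},
      Γ.IsSaS Cardinal.aleph0 (2 ^ Cardinal.aleph0) ∧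
      Γ.toSimpleGraph.Connected ∧
      Γ.toSimpleGraph.egirth = 4 ∧
      Γ.IsLocallySymmetric 3 :=
  ⟨codeGraph, codeGraph.isSaS, codeGraph.connected, codeGraph.egirth_eq,
    codeGraph.isHomogeneous.isLocallySymmetric 3⟩
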